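/- Let $r\ge 0$ and $n\ge 1$ be integers. Let $Z^r_n$ (the $r$-chainlink poset) be the partial order on $[n]=\{1,\dots,n\}$ defined as follows: write $i-1=a(r+1)+b$ and $j-1=c(r+1)+d$ with $a,c\ge 0$ and $0\le b,d\le r$; then $i\le_{Z^r_n} j$ if and only if $a\ge c$ and $a+b\le c+d$. Let $\mathcal L(Z^r_n)$ be its set of linear extensions, i.e. the permutations $\pi\in S_n$ such that $i<_{Z^r_n}j$ implies $\pi^{-1}(i)<\pi^{-1}(j)$. For $w\in S_n$ let $\mathrm{des}_r(w)=|\{\,1\le i<n : w(i)>w(i+1)+r\,\}|$, and define the $r$-chainlink Eulerian polynomial $$Z^r_n(t)=\sum_{\pi\in\mathcal L(Z^r_n)}t^{1+\mathrm{des}_r(\pi)}.$$ If $n\ge r+1$, then there exist nonnegative integers $\gamma_{n,j}$ (depending on $r$, $n$ and $j$) such that $$Z^r_n(t)=t\cdot\sum_{0\le 2j\le n-r-1}\gamma_{n,j}\,t^j(1+t)^{n-r-1-2j}.$$ In the degenerate case $1\le n\le r$, one has $Z^r_n(t)=t$. -/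

import Mathlib

open Polynomial

/-- The order relation of the `r`-chainlink poset on `n` elements. The label `x ∈ {1, …, n}` is
represented by `x - 1 : Fin n`. Writing `x - 1 = a * (r + 1) + b` with `0 ≤ b ≤ r` (block `a`,
rank `b`) and `y - 1 = c * (r + 1) + d` likewise, `x ≤ y` iff `0 ≤ a - c ≤ d - b`. Thus its
covering relations are `(a, b) < (a, b + 1)` and `(a + 1, b) < (a, b + 1)`. -/
def chainlinkLE (r n : ℕ) (i j : Fin n) : Prop :=
  (j : ℕ) / (r + 1) ≤ (i : ℕ) / (r + 1) ∧
    (i : ℕ) / (r + 1) + (i : ℕ) % (r + 1) ≤ (j : ℕ) / (r + 1) + (j : ℕ) % (r + 1)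

/-- The `r`-chainlink poset on `n` elements (not the usual order of `Fin n`). -/
@[reducible] def chainlinkPoset (r n : ℕ) : PartialOrder (Fin n) where
  le := chainlinkLE r n
  lt i j := chainlinkLE r n i j ∧ ¬ chainlinkLE r n j i
  lt_iff_le_not_ge _ _ := Iff.rfl
  le_refl _ := ⟨le_rfl, le_rfl⟩
  le_trans _ _ _ h₁ h₂ := ⟨h₂.1.trans h₁.1, h₁.2.trans h₂.2⟩
  le_antisymm i j h₁ h₂ := by
    have hq : (i : ℕ) / (r + 1) = (j : ℕ) / (r + 1) := le_antisymm h₂.1 h₁.1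
    have hm : (i : ℕ) % (r + 1) = (j : ℕ) % (r + 1) := by
      have h3 := h₁.2
      have h4 := h₂.2
      omega
    apply Fin.ext
    rw [← Nat.div_add_mod (i : ℕ) (r + 1), ← Nat.div_add_mod (j : ℕ) (r + 1), hq, hm]

/-- The permutation `π`, read as the chain `π(1) < π(2) < ⋯ < π(n)`, refines the partial
order `P`: whenever `i <_P j`, the label `i` stands before `j` in the word of `π`. -/
def IsLinearExtension {n : ℕ} (P : PartialOrder (Fin n)) (π : Equiv.Perm (Fin n)) : Prop :=
  ∀ i j : Fin n, P.lt i j → π.symm i < π.symm j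

open Classical in
/-- The set of linear extensions of `P`, as a set of permutations. -/
noncomputable def linearExtensions {n : ℕ} (P : PartialOrder (Fin n)) :
    Finset (Equiv.Perm (Fin n)) :=
  {π : Equiv.Perm (Fin n) | IsLinearExtension P π}

/-- The `r`-descent set of `w`: the positions `i < n` with `w(i) > w(i + 1) + r`. -/
def descentSet {n : ℕ} (r : ℕ) (w : Equiv.Perm (Fin n)) : Finset (Fin n) :=
  {i : Fin n | ∃ h : (i : ℕ) + 1 < n, (w ⟨(i : ℕ) + 1, h⟩ : ℕ) + r < (w i : ℕ)}

/-- The number of `r`-descents of `w`. -/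
def descentNumber {n : ℕ} (r : ℕ) (w : Equiv.Perm (Fin n)) : ℕ :=
  (descentSet r w).card

/-- The `r`-chainlink Eulerian polynomial, the sum of `t ^ (1 + des_r π)` over the linear
extensions `π` of the `r`-chainlink poset on `n` elements. -/
noncomputable def chainlinkEulerian (r n : ℕ) : ℤ[X] :=
  ∑ π ∈ linearExtensions (chainlinkPoset r n), X ^ (1 + descentNumber r π)

/-! The `r`-descents of a linear extension are its descents for a natural labeling of the poset
(`descent_iff_chainlinkLabel_lt`). By the theory of P-partitions (`one_sub_X_pow_mul_orderMaps`),
`Z^r_n(t) / (t (1 - t)^n)` is therefore the generating function of order-preserving maps counted by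
their maximum.

Covers raise the rank by one, so a map `f` is weakly increasing along covers exactly when `h = 2 f +
rank` is strictly increasing along them. For `n ≥ r + 1` every element lies below one of rank `r`,
and maximum `m` becomes maximum `2 m + r` (`card_layered_univ`).

Read by increasing value, such an `h` splits into runs of constant parity. The last run is a set of
maximal elements on which the values are independent (`card_layered_eq_sum`). A run of `k` elements
contributes `A_k(t) / (t (1 - t)^k)` with `A_k` the Eulerian polynomial, and `A_k(t) / t` is
`γ`-nonnegative of degree `k - 1` (`exists_powDiffSeries`). Each run thus loses one in degree, while
every passage from an odd run to an even one gives a factor `t`, which counts two in the center.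
Apart from a power of `t` fixed by the rank, all the products of Eulerian polynomials then share one
center of symmetry, and their sum stays `γ`-nonnegative (`exists_layeredSeries`). -/

/-! ### The cone of `γ`-nonnegative polynomials -/

/-- The polynomials with nonnegative integer `γ`-coefficients and center of symmetry `d / 2`. -/
noncomputable def gammaCone (d : ℕ) : AddSubmonoid ℤ[X] :=
  AddSubmonoid.closure {p | ∃ j e : ℕ, 2 * j + e = d ∧ p = X ^ j * (1 + X) ^ e}

theorem monomial_mem_gammaCone {d : ℕ} (j e : ℕ) (h : 2 * j + e = d) :
    (X ^ j * (1 + X) ^ e : ℤ[X]) ∈ gammaCone d :=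
  AddSubmonoid.subset_closure ⟨j, e, h, rfl⟩

theorem mul_mem_gammaCone {d e : ℕ} {p q : ℤ[X]} (hp : p ∈ gammaCone d) (hq : q ∈ gammaCone e) :
    p * q ∈ gammaCone (d + e) := by
  induction hp using AddSubmonoid.closure_induction with
  | mem p hp =>
    obtain ⟨j, k, h, rfl⟩ := hp
    induction hq using AddSubmonoid.closure_induction with
    | mem q hq =>
      obtain ⟨j', k', h', rfl⟩ := hq
      have := monomial_mem_gammaCone (d := d + e) (j + j') (k + k') (by omega)
      convert this using 1
      ring
    | zero => simp
    | add q q' _ _ h1 h2 => rw [mul_add]; exact add_mem h1 h2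
  | zero => simp
  | add p p' _ _ h1 h2 => rw [add_mul]; exact add_mem h1 h2

theorem X_mul_mem_gammaCone {d : ℕ} {p : ℤ[X]} (hp : p ∈ gammaCone d) :
    X * p ∈ gammaCone (d + 2) := by
  have h : (X : ℤ[X]) ∈ gammaCone 2 := by
    simpa using monomial_mem_gammaCone (d := 2) 1 0 rfl
  rw [add_comm]
  exact mul_mem_gammaCone h hp

theorem exists_gamma_of_mem_gammaCone {d : ℕ} {p : ℤ[X]} (hp : p ∈ gammaCone d) :
    ∃ γ : ℕ → ℕ, p = ∑ j ∈ Finset.range (d / 2 + 1),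
      (γ j : ℤ[X]) * (X ^ j * (1 + X) ^ (d - 2 * j)) := by
  induction hp using AddSubmonoid.closure_induction with
  | mem p hp =>
    obtain ⟨j, e, h, rfl⟩ := hp
    refine ⟨fun i => if i = j then 1 else 0, ?_⟩
    rw [Finset.sum_eq_single_of_mem j (Finset.mem_range.2 (by omega))]
    · rw [show d - 2 * j = e by omega]; simp
    · intro i _ hi; simp [hi]
  | zero => exact ⟨fun _ => 0, by simp⟩
  | add p q _ _ h1 h2 =>
    obtain ⟨γ, rfl⟩ := h1
    obtain ⟨δ, rfl⟩ := h2
    refine ⟨fun i => γ i + δ i, ?_⟩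
    rw [← Finset.sum_add_distrib]
    exact Finset.sum_congr rfl fun i _ => by push_cast; ring

/-- The recurrence operator of the Eulerian polynomials preserves nonnegativity of the
`γ`-coefficients. -/
theorem eulerian_step_mem_gammaCone {d : ℕ} {p : ℤ[X]} (hp : p ∈ gammaCone d) :
    (1 - X) * derivative (X * p) + ((d : ℤ[X]) + 2) * X * p ∈ gammaCone (d + 1) := by
  induction hp using AddSubmonoid.closure_induction with
  | mem p hp =>
    obtain ⟨j, e, h, rfl⟩ := hp
    -- The image of `X ^ j * (1 + X) ^ e` is `(j + 1) X^j (1 + X)^(e+1) + 2 e X^(j+1) (1 +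
    -- X)^(e-1)`; the second term vanishes for `e = 0`.
    have h1 : (j + 1) • (X ^ j * (1 + X) ^ (e + 1) : ℤ[X]) ∈ gammaCone (d + 1) :=
      AddSubmonoid.nsmul_mem _ (monomial_mem_gammaCone _ _ (by omega)) _
    have hd : (d : ℤ[X]) = 2 * j + e := by rw [← h]; push_cast; ring
    rcases e with _ | e
    · convert h1 using 1
      simp only [derivative_mul, derivative_X, derivative_pow, derivative_add,
        derivative_one, nsmul_eq_mul, hd]
      rcases j with _ | j <;> simp <;> ring
    · have h2 : (2 * (e + 1)) • (X ^ (j + 1) * (1 + X) ^ e : ℤ[X]) ∈ gammaCone (d + 1) :=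
        AddSubmonoid.nsmul_mem _ (monomial_mem_gammaCone _ _ (by omega)) _
      convert add_mem h1 h2 using 1
      simp only [derivative_mul, derivative_X, derivative_pow, derivative_add,
        derivative_one, nsmul_eq_mul, hd]
      rcases j with _ | j <;> simp <;> ring
  | zero => simp
  | add p q _ _ h1 h2 =>
    convert add_mem h1 h2 using 1
    rw [mul_add X, derivative_add]
    ring

/-! ### Eulerian polynomials as numerators of power series -/

/-- The generating function of the powers `(w + 1) ^ a`. -/
noncomputable def powSeries (a : ℕ) : PowerSeries ℤ := PowerSeries.mk fun w => ((w : ℤ) + 1) ^ a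

/-- The generating function of the differences `(w + 1) ^ a - w ^ a`. -/
noncomputable def powDiffSeries (a : ℕ) : PowerSeries ℤ :=
  PowerSeries.mk fun w => ((w : ℤ) + 1) ^ a - (w : ℤ) ^ a

theorem one_sub_X_mul_powSeries (a : ℕ) (ha : a ≠ 0) :
    (1 - PowerSeries.X) * powSeries a = powDiffSeries a := by
  ext w
  rw [sub_mul, one_mul, map_sub]
  rcases w with _ | w
  · simp [powSeries, powDiffSeries, ha]
  · simp [powSeries, powDiffSeries, PowerSeries.coeff_succ_X_mul]

theorem powSeries_succ (a : ℕ) :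
    powSeries (a + 1) = PowerSeries.derivative ℤ (PowerSeries.X * powSeries a) := by
  ext w
  rw [PowerSeries.coeff_derivative, PowerSeries.coeff_succ_X_mul]
  simp [powSeries, pow_succ]

/-- The numerator is the Eulerian polynomial of degree `a`. Multiplying the series by `X` and
differentiating raises the exponent by one and acts on numerators by the Eulerian recurrence. -/
theorem exists_powSeries (a : ℕ) : ∃ p ∈ gammaCone a,
    (1 - PowerSeries.X) ^ (a + 2) * powSeries (a + 1) = (p : PowerSeries ℤ) := by
  induction a with
  | zero =>
    refine ⟨1, by simpa using monomial_mem_gammaCone (d := 0) 0 0 rfl, ?_⟩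
    rw [show 0 + 2 = 1 + 1 from rfl, pow_succ, mul_assoc, one_sub_X_mul_powSeries _ (by simp)]
    ext w
    rcases w with _ | w <;> simp [powDiffSeries, sub_mul, PowerSeries.coeff_succ_X_mul]
  | succ a ih =>
    obtain ⟨p, hp, h⟩ := ih
    -- The term with factor `a + 2` cancels what the product rule yields from `(1 - X) ^ (a + 2)`.
    refine ⟨_, eulerian_step_mem_gammaCone hp, ?_⟩
    rw [powSeries_succ]
    have h3 : (PowerSeries.derivative ℤ) (PowerSeries.X * (p : PowerSeries ℤ))
        = ((derivative (X * p) : ℤ[X]) : PowerSeries ℤ) := by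
      rw [← Polynomial.coe_X, ← Polynomial.coe_mul]
      exact PowerSeries.derivative_coe _
    have h4 : (PowerSeries.derivative ℤ) (1 - PowerSeries.X) = -1 := by simp
    have h5 : ((((a : ℤ[X]) + 2 : ℤ[X])) : PowerSeries ℤ) = (a : PowerSeries ℤ) + 2 := by
      simpa using map_natCast (Polynomial.coeToPowerSeries.ringHom (R := ℤ)) (a + 2)
    rw [Polynomial.coe_add, Polynomial.coe_mul, Polynomial.coe_mul, Polynomial.coe_mul,
      Polynomial.coe_sub, Polynomial.coe_one, Polynomial.coe_X, h5, ← h3]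
    simp only [← h, Derivation.leibniz, Derivation.leibniz_pow, h4, smul_eq_mul, nsmul_eq_mul,
      PowerSeries.derivative_X]
    simp only [show a + 2 - 1 = a + 1 from rfl]
    push_cast
    ring

theorem exists_powDiffSeries (a : ℕ) (ha : a ≠ 0) : ∃ p ∈ gammaCone (a - 1),
    (1 - PowerSeries.X) ^ a * powDiffSeries a = (p : PowerSeries ℤ) := by
  obtain ⟨a, rfl⟩ := Nat.exists_eq_succ_of_ne_zero ha
  obtain ⟨p, hp, h⟩ := exists_powSeries a
  refine ⟨p, hp, ?_⟩
  rw [← one_sub_X_mul_powSeries _ ha, ← h, ← mul_assoc, ← pow_succ]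

/-! ### Layered maps and their decomposition into parity runs -/

section Layered

variable {V : Type*} [Fintype V] [DecidableEq V]

open Classical in
/-- The maps `h` supported on `S` with maximum `v` that are strictly increasing along `E` and
congruent to `ρ` modulo `2`. -/
noncomputable def layered (ρ : V → ℕ) (E : V → V → Prop) (S : Finset V) (v : ℕ) :
    Finset (V → ℕ) :=
  {h ∈ Fintype.piFinset fun x => if x ∈ S then Finset.range (v + 1) else {0} |
    (∀ x ∈ S, h x % 2 = ρ x % 2) ∧ (∀ x ∈ S, ∀ y ∈ S, E x y → h x < h y) ∧ ∃ x ∈ S, h x = v}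

/-- The maps supported on `A` with maximum `v`, at least `l` on `A` and congruent to `v` there
modulo `2`. -/
def topFill (A : Finset V) (l v : ℕ) : Finset (V → ℕ) :=
  {h ∈ Fintype.piFinset fun x => if x ∈ A then Finset.range (v + 1) else {0} |
    (∀ x ∈ A, l ≤ h x ∧ h x % 2 = v % 2) ∧ ∃ x ∈ A, h x = v}

theorem mem_piFinset_ite_range {S : Finset V} {v : ℕ} {h : V → ℕ} :
    (h ∈ Fintype.piFinset fun x => if x ∈ S then Finset.range v else {0}) ↔
      (∀ x ∉ S, h x = 0) ∧ ∀ x ∈ S, h x < v := by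
  simp only [Fintype.mem_piFinset]
  constructor
  · intro H
    refine ⟨fun x hx => ?_, fun x hx => ?_⟩
    · simpa [hx] using H x
    · simpa [hx] using H x
  · rintro ⟨h1, h2⟩ x
    by_cases hx : x ∈ S
    · simpa [hx] using h2 x hx
    · simpa [hx] using h1 x hx

theorem mem_layered {ρ : V → ℕ} {E : V → V → Prop} {S : Finset V} {v : ℕ} {h : V → ℕ} :
    h ∈ layered ρ E S v ↔ (∀ x ∉ S, h x = 0) ∧ (∀ x ∈ S, h x ≤ v) ∧
      (∀ x ∈ S, h x % 2 = ρ x % 2) ∧ (∀ x ∈ S, ∀ y ∈ S, E x y → h x < h y) ∧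
      ∃ x ∈ S, h x = v := by
  classical
  simp only [layered, Finset.mem_filter, mem_piFinset_ite_range, Nat.lt_succ_iff, and_assoc]

theorem mem_topFill {A : Finset V} {l v : ℕ} {h : V → ℕ} :
    h ∈ topFill A l v ↔ (∀ x ∉ A, h x = 0) ∧ (∀ x ∈ A, h x ≤ v) ∧
      (∀ x ∈ A, l ≤ h x ∧ h x % 2 = v % 2) ∧ ∃ x ∈ A, h x = v := by
  simp only [topFill, Finset.mem_filter, mem_piFinset_ite_range, Nat.lt_succ_iff, and_assoc]

theorem card_piFinset_ite_range (A : Finset V) (k : ℕ) :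
    (Fintype.piFinset fun x => if x ∈ A then Finset.range k else {0}).card = k ^ A.card := by
  rw [Fintype.card_piFinset]
  simp only [apply_ite Finset.card, Finset.card_range, Finset.card_singleton]
  simp

/-- Rescaling `l + 2 * i` to `i` leaves the maps from `A` to `{0, …, k}` that are not everywhere
below `k`. For empty `A` both sides are zero. -/
theorem card_topFill (A : Finset V) (l k : ℕ) :
    ((topFill A l (l + 2 * k)).card : ℤ) = ((k : ℤ) + 1) ^ A.card - (k : ℤ) ^ A.card := by
  have hsub : (Fintype.piFinset fun x => if x ∈ A then Finset.range k else {0}) ⊆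
      (Fintype.piFinset fun x => if x ∈ A then Finset.range (k + 1) else {0}) := by
    intro h
    simp only [mem_piFinset_ite_range]
    exact fun H => ⟨H.1, fun x hx => (H.2 x hx).trans (Nat.lt_succ_self _)⟩
  have hcard := Finset.card_sdiff_add_card_eq_card hsub
  rw [card_piFinset_ite_range, card_piFinset_ite_range] at hcard
  have : (topFill A l (l + 2 * k)).card =
      ((Fintype.piFinset fun x => if x ∈ A then Finset.range (k + 1) else {0}) \
        (Fintype.piFinset fun x => if x ∈ A then Finset.range k else {0})).card := by
    refine Finset.card_nbij' (fun h x => (h x - l) / 2)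
      (fun g x => if x ∈ A then l + 2 * g x else 0) ?_ ?_ ?_ ?_
    · intro h hh
      simp only [Finset.mem_coe, mem_topFill, Finset.mem_sdiff, mem_piFinset_ite_range] at hh ⊢
      obtain ⟨h0, h1, h2, x, hx, hxv⟩ := hh
      refine ⟨⟨fun y hy => by simp [h0 y hy], fun y hy => ?_⟩, fun H => ?_⟩
      · have := h1 y hy; omega
      · have := H.2 x hx; omega
    · intro g hg
      simp only [Finset.mem_coe, mem_topFill, Finset.mem_sdiff, mem_piFinset_ite_range] at hg ⊢
      obtain ⟨⟨h0, h1⟩, h2⟩ := hg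
      refine ⟨fun x hx => by simp [hx], fun x hx => ?_, fun x hx => ?_, ?_⟩
      · have := h1 x hx; simp only [hx, if_true]; omega
      · simp only [hx, if_true]; omega
      · by_contra! hcon
        refine h2 ⟨h0, fun x hx => ?_⟩
        have h3 := hcon x hx
        have h4 := h1 x hx
        simp only [hx, if_true] at h3
        omega
    · intro h hh
      simp only [Finset.mem_coe, mem_topFill] at hh
      obtain ⟨h0, h1, h2, -⟩ := hh
      funext x
      by_cases hx : x ∈ A
      · have := h2 x hx
        simp only [hx, if_true]; omega
      · simp [hx, h0 x hx]
    · intro g hg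
      simp only [Finset.mem_coe, Finset.mem_sdiff, mem_piFinset_ite_range] at hg
      funext x
      by_cases hx : x ∈ A
      · simp [hx]
      · simp [hx, hg.1.1 x hx]
  rw [this]
  have h2 : ((((Fintype.piFinset fun x => if x ∈ A then Finset.range (k + 1) else {0}) \
        (Fintype.piFinset fun x => if x ∈ A then Finset.range k else {0})).card : ℤ)
        + (k : ℤ) ^ A.card) = ((k : ℤ) + 1) ^ A.card := by exact_mod_cast hcard
  linarith

open Classical in
/-- The sets of `E`-maximal elements of `S` of rank congruent to `c` modulo `2`. -/
noncomputable def topRuns (ρ : V → ℕ) (E : V → V → Prop) (S : Finset V) (c : ℕ) :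
    Finset (Finset V) :=
  {A ∈ S.powerset | ∀ x ∈ A, ρ x % 2 = c % 2 ∧ ∀ y ∈ S, ¬ E x y}

theorem mem_topRuns {ρ : V → ℕ} {E : V → V → Prop} {S A : Finset V} {c : ℕ} :
    A ∈ topRuns ρ E S c ↔ A ⊆ S ∧ ∀ x ∈ A, ρ x % 2 = c % 2 ∧ ∀ y ∈ S, ¬ E x y := by
  classical
  simp [topRuns]

/-- The largest value of `h` of parity opposite to `c`. -/
def lowerMax (ρ : V → ℕ) (S : Finset V) (c : ℕ) (h : V → ℕ) : ℕ :=
  {x ∈ S | ρ x % 2 ≠ c % 2}.sup h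

/-- The elements at which `h` exceeds all values of parity opposite to `c`. -/
def topRun (ρ : V → ℕ) (S : Finset V) (c : ℕ) (h : V → ℕ) : Finset V :=
  {x ∈ S | lowerMax ρ S c h < h x}

/-- Splitting a layered map into its last run of values of constant parity and the rest. -/
theorem card_layered_eq_sum {ρ : V → ℕ} {E : V → V → Prop} (hE : ∀ x y, E x y → ρ y = ρ x + 1)
    {S : Finset V} {v : ℕ} (hS : ∃ x ∈ S, ρ x % 2 ≠ v % 2) :
    (layered ρ E S v).card = ∑ A ∈ topRuns ρ E S v,
      ∑ u ∈ (Finset.range v).filter (fun u => u % 2 ≠ v % 2),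
        (layered ρ E (S \ A) u).card * (topFill A (u + 1) v).card := by
  obtain ⟨x₀, hx₀, hx₀v⟩ := hS
  -- With no element of the opposite parity, `lowerMax` would be the default `0` and not a value of
  -- the map.
  have hne : ({x ∈ S | ρ x % 2 ≠ v % 2} : Finset V).Nonempty := ⟨x₀, by simp [hx₀, hx₀v]⟩
  rw [← Finset.sum_product', Finset.card_eq_sum_card_fiberwise
    (f := fun h => (topRun ρ S v h, lowerMax ρ S v h))
    (t := topRuns ρ E S v ×ˢ (Finset.range v).filter (fun u => u % 2 ≠ v % 2))]
  · refine Finset.sum_congr rfl ?_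
    rintro ⟨A, u⟩ hAu
    simp only [Finset.mem_product, mem_topRuns, Finset.mem_filter, Finset.mem_range] at hAu
    obtain ⟨⟨hAS, hA⟩, huv, hu⟩ := hAu
    rw [← Finset.card_product]
    -- Both pieces are extended by zero off disjoint supports, so addition glues them back together.
    refine Finset.card_nbij'
      (fun h => (fun x => if x ∈ S \ A then h x else 0, fun x => if x ∈ A then h x else 0))
      (fun g x => g.1 x + g.2 x) ?_ ?_ ?_ ?_
    · intro h hh
      simp only [Finset.mem_coe, Finset.mem_filter, Prod.mk.injEq, mem_layered] at hh
      obtain ⟨⟨h0, h1, h2, h3, x, hx, hxv⟩, hA', hu'⟩ := hh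
      have memA : ∀ y ∈ S, (y ∈ A ↔ u < h y) := by
        intro y hy
        rw [← hA', topRun, Finset.mem_filter, hu']
        simp [hy]
      simp only [Finset.mem_coe, Finset.mem_product, mem_layered, mem_topFill]
      refine ⟨⟨fun y hy => by simp only [hy, if_false], fun y hy => ?_, fun y hy => ?_,
        fun y hy z hz hyz => ?_, ?_⟩, fun y hy => by simp only [hy, if_false],
        fun y hy => ?_, fun y hy => ?_, ?_⟩
      · simp only [hy, if_true]
        rw [Finset.mem_sdiff] at hy
        have := memA y hy.1
        by_contra! hc
        exact hy.2 (this.2 hc)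
      · simp only [hy, if_true]
        exact h2 y (Finset.mem_sdiff.1 hy).1
      · simp only [hy, hz, if_true]
        exact h3 y (Finset.mem_sdiff.1 hy).1 z (Finset.mem_sdiff.1 hz).1 hyz
      · obtain ⟨y, hy, hyu⟩ := Finset.exists_mem_eq_sup _ hne h
        rw [Finset.mem_filter] at hy
        have hyu' : h y = u := by rw [← hu', lowerMax, hyu]
        have hyA : y ∈ S \ A := by
          rw [Finset.mem_sdiff, memA y hy.1]
          exact ⟨hy.1, by omega⟩
        exact ⟨y, hyA, by simp only [hyA, if_true, hyu']⟩
      · simp only [hy, if_true]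
        exact h1 y (hAS hy)
      · simp only [hy, if_true]
        exact ⟨(memA y (hAS hy)).1 hy, (h2 y (hAS hy)).trans (hA y hy).1⟩
      · have hxA : x ∈ A := by rw [memA x hx]; omega
        exact ⟨x, hxA, by simp only [hxA, if_true, hxv]⟩
    · rintro ⟨g, f⟩ hgf
      simp only [Finset.mem_coe, Finset.mem_product, mem_layered, mem_topFill] at hgf
      obtain ⟨⟨g0, g1, g2, g3, x, hx, hxu⟩, f0, f1, f2, y, hy, hyv⟩ := hgf
      have vA : ∀ z ∈ A, g z + f z = f z := fun z hz => by
        rw [g0 z (fun hz' => (Finset.mem_sdiff.1 hz').2 hz), zero_add]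
      have vS : ∀ z ∈ S \ A, g z + f z = g z := fun z hz => by
        rw [f0 z (Finset.mem_sdiff.1 hz).2, add_zero]
      have hlow : lowerMax ρ S v (fun x => g x + f x) = u := by
        apply le_antisymm
        · refine Finset.sup_le fun z hz => ?_
          rw [Finset.mem_filter] at hz
          have hzA : z ∈ S \ A := Finset.mem_sdiff.2 ⟨hz.1, fun hzA => hz.2 (hA z hzA).1⟩
          rw [vS z hzA]
          exact g1 z hzA
        · have h1 : x ∈ ({x ∈ S | ρ x % 2 ≠ v % 2} : Finset V) := by
            rw [Finset.mem_filter]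
            refine ⟨(Finset.mem_sdiff.1 hx).1, ?_⟩
            rw [← g2 x hx, hxu]
            exact hu
          calc u = g x + f x := by rw [vS x hx, hxu]
            _ ≤ _ := Finset.le_sup (f := fun x => g x + f x) h1
      simp only [Finset.mem_coe, Finset.mem_filter, Prod.mk.injEq, mem_layered]
      refine ⟨⟨fun z hz => ?_, fun z hz => ?_, fun z hz => ?_, fun z hz w hw hzw => ?_,
        y, hAS hy, ?_⟩, ?_, hlow⟩
      · rw [g0 z (fun h => hz (Finset.mem_sdiff.1 h).1), f0 z (fun h => hz (hAS h))]
      · by_cases hzA : z ∈ A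
        · rw [vA z hzA]; exact f1 z hzA
        · have hz' := Finset.mem_sdiff.2 ⟨hz, hzA⟩
          rw [vS z hz']; exact (g1 z hz').trans huv.le
      · by_cases hzA : z ∈ A
        · rw [vA z hzA, (f2 z hzA).2, (hA z hzA).1]
        · have hz' := Finset.mem_sdiff.2 ⟨hz, hzA⟩
          rw [vS z hz']; exact g2 z hz'
      · have hzA : z ∉ A := fun h => (hA z h).2 w hw hzw
        have hz' := Finset.mem_sdiff.2 ⟨hz, hzA⟩
        rw [vS z hz']
        by_cases hwA : w ∈ A
        · rw [vA w hwA]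
          have := g1 z hz'
          have := (f2 w hwA).1
          omega
        · have hw' := Finset.mem_sdiff.2 ⟨hw, hwA⟩
          rw [vS w hw']; exact g3 z hz' w hw' hzw
      · rw [vA y hy, hyv]
      · ext z
        rw [topRun, Finset.mem_filter, hlow]
        constructor
        · rintro ⟨hzS, hz⟩
          by_contra hzA
          have hz' := Finset.mem_sdiff.2 ⟨hzS, hzA⟩
          rw [vS z hz'] at hz
          have := g1 z hz'
          omega
        · intro hz
          refine ⟨hAS hz, ?_⟩
          rw [vA z hz]
          have := (f2 z hz).1
          omega
    · intro h hh
      simp only [Finset.mem_coe, Finset.mem_filter, Prod.mk.injEq, mem_layered] at hh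
      obtain ⟨⟨h0, -⟩, -⟩ := hh
      funext z
      by_cases hzA : z ∈ A
      · simp [hzA]
      · by_cases hzS : z ∈ S
        · simp [hzA, hzS]
        · simp [hzA, hzS, h0 z hzS]
    · rintro ⟨g, f⟩ hgf
      simp only [Finset.mem_coe, Finset.mem_product, mem_layered, mem_topFill] at hgf
      obtain ⟨⟨g0, -⟩, f0, -⟩ := hgf
      refine Prod.ext (funext fun z => ?_) (funext fun z => ?_)
      · by_cases hz : z ∈ S \ A
        · simp only [hz, if_true]
          rw [f0 z (Finset.mem_sdiff.1 hz).2, add_zero]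
        · simp only [hz, if_false]
          rw [g0 z hz]
      · by_cases hz : z ∈ A
        · simp only [hz, if_true]
          rw [g0 z (fun h => (Finset.mem_sdiff.1 h).2 hz), zero_add]
        · simp only [hz, if_false]
          rw [f0 z hz]
  · intro h hh
    simp only [Finset.mem_coe, mem_layered] at hh
    obtain ⟨h0, h1, h2, h3, x, hx, hxv⟩ := hh
    obtain ⟨y, hy, hyu⟩ := Finset.exists_mem_eq_sup _ hne h
    have hyu' : lowerMax ρ S v h = h y := hyu
    rw [Finset.mem_filter] at hy
    have hpar : ∀ z ∈ S, h y < h z → ρ z % 2 = v % 2 := by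
      intro z hz hyz
      by_contra hc
      have : h z ≤ lowerMax ρ S v h := Finset.le_sup (f := h) (by simp [hz, hc])
      omega
    simp only [Finset.mem_coe, Finset.mem_product, mem_topRuns, Finset.mem_filter,
      Finset.mem_range, topRun, hyu']
    refine ⟨⟨Finset.filter_subset _ _, fun z hz => ?_⟩, ?_, ?_⟩
    -- A successor of `z` would have a still larger value, hence lie in the run and have the parity
    -- of `z`; but `E` changes the parity of the rank.
    · refine ⟨hpar z hz.1 hz.2, fun w hw hzw => ?_⟩
      have h4 := h3 z hz.1 w hw hzw
      have h5 := hpar w hw (by omega)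
      have h6 := hpar z hz.1 hz.2
      have := hE z w hzw
      omega
    · have h4 := h1 y hy.1
      have h5 := h2 y hy.1
      have : h y ≠ v := fun h => hy.2 (by rw [← h5, h])
      omega
    · rw [h2 y hy.1]; exact hy.2

/-- The generating function of the numbers of layered maps with maximum `2 * w + c`. -/
noncomputable def layeredSeries (ρ : V → ℕ) (E : V → V → Prop) (S : Finset V) (c : ℕ) :
    PowerSeries ℤ :=
  PowerSeries.mk fun w => ((layered ρ E S (2 * w + c)).card : ℤ)

/-- With `u = 2 p` the run fills `u + 1, u + 3, …, 2 w + 1`, which is `topFill` with `k = w - p`.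
The sum over `u` is thus a Cauchy product. -/
theorem layeredSeries_one {ρ : V → ℕ} {E : V → V → Prop} (hE : ∀ x y, E x y → ρ y = ρ x + 1)
    {S : Finset V} (hS : ∃ x ∈ S, ρ x % 2 ≠ 1) :
    layeredSeries ρ E S 1 = ∑ A ∈ topRuns ρ E S 1,
      layeredSeries ρ E (S \ A) 0 * powDiffSeries A.card := by
  ext w
  have hm : (2 * w + 1) % 2 = 1 := by omega
  have ht : topRuns ρ E S (2 * w + 1) = topRuns ρ E S 1 := by
    ext A; simp [mem_topRuns, hm]
  rw [map_sum, layeredSeries, PowerSeries.coeff_mk, card_layered_eq_sum hE (by simpa [hm] using hS),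
    ht, Nat.cast_sum]
  refine Finset.sum_congr rfl fun A _ => ?_
  rw [PowerSeries.coeff_mul, Nat.cast_sum]
  symm
  refine Finset.sum_bij' (fun p _ => 2 * p.1) (fun u _ => (u / 2, w - u / 2)) ?_ ?_ ?_ ?_ ?_
  · rintro ⟨p, q⟩ hp
    simp only [Finset.HasAntidiagonal.mem_antidiagonal, Finset.mem_filter, Finset.mem_range] at hp ⊢
    omega
  · intro u hu
    simp only [Finset.HasAntidiagonal.mem_antidiagonal, Finset.mem_filter, Finset.mem_range] at hu ⊢
    omega
  · rintro ⟨p, q⟩ hp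
    simp only [Finset.HasAntidiagonal.mem_antidiagonal, Prod.mk.injEq] at hp ⊢
    omega
  · intro u hu
    simp only [Finset.mem_filter, Finset.mem_range] at hu ⊢
    omega
  · rintro ⟨p, q⟩ hp
    simp only [Finset.HasAntidiagonal.mem_antidiagonal] at hp
    rw [show 2 * w + 1 = (2 * p + 1) + 2 * q by omega, Nat.cast_mul, card_topFill]
    simp [layeredSeries, powDiffSeries]

/-- Here `u = 2 p + 1` and the run starts at `2 (p + 1)`, so `k = w - p - 1`; this shift is the
factor `X`. -/
theorem layeredSeries_zero {ρ : V → ℕ} {E : V → V → Prop} (hE : ∀ x y, E x y → ρ y = ρ x + 1)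
    {S : Finset V} (hS : ∃ x ∈ S, ρ x % 2 ≠ 0) :
    layeredSeries ρ E S 0 = ∑ A ∈ topRuns ρ E S 0,
      PowerSeries.X * (layeredSeries ρ E (S \ A) 1 * powDiffSeries A.card) := by
  ext w
  have hm : (2 * w) % 2 = 0 := by omega
  have ht : topRuns ρ E S (2 * w + 0) = topRuns ρ E S 0 := by
    ext A; simp [mem_topRuns]
  rw [map_sum, layeredSeries, PowerSeries.coeff_mk, card_layered_eq_sum hE (by simpa using hS),
    ht, Nat.cast_sum]
  refine Finset.sum_congr rfl fun A _ => ?_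
  rw [Nat.cast_sum]
  rcases w with _ | w
  · simp
  rw [PowerSeries.coeff_succ_X_mul, PowerSeries.coeff_mul]
  symm
  refine Finset.sum_bij' (fun p _ => 2 * p.1 + 1) (fun u _ => (u / 2, w - u / 2)) ?_ ?_ ?_ ?_ ?_
  · rintro ⟨p, q⟩ hp
    simp only [Finset.HasAntidiagonal.mem_antidiagonal, Finset.mem_filter, Finset.mem_range] at hp ⊢
    omega
  · intro u hu
    simp only [Finset.HasAntidiagonal.mem_antidiagonal, Finset.mem_filter, Finset.mem_range] at hu ⊢
    omega
  · rintro ⟨p, q⟩ hp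
    simp only [Finset.HasAntidiagonal.mem_antidiagonal, Prod.mk.injEq] at hp ⊢
    omega
  · intro u hu
    simp only [Finset.mem_filter, Finset.mem_range] at hu ⊢
    omega
  · rintro ⟨p, q⟩ hp
    simp only [Finset.HasAntidiagonal.mem_antidiagonal] at hp
    rw [show 2 * (w + 1) + 0 = (2 * p + 1 + 1) + 2 * q by omega, Nat.cast_mul, card_topFill]
    simp [layeredSeries, powDiffSeries]

/-- `E` changes parity, so it imposes no condition inside `S`, and the whole map is a single run
starting at `0`. -/
theorem layeredSeries_of_even {ρ : V → ℕ} {E : V → V → Prop} (hE : ∀ x y, E x y → ρ y = ρ x + 1)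
    {S : Finset V} (hS : ∀ x ∈ S, ρ x % 2 = 0) :
    layeredSeries ρ E S 0 = powDiffSeries S.card := by
  ext w
  have h : layered ρ E S (0 + 2 * w) = topFill S 0 (0 + 2 * w) := by
    ext h
    rw [mem_layered, mem_topFill]
    refine and_congr_right fun _ => and_congr_right fun _ => ?_
    constructor
    · rintro ⟨h2, -, h4⟩
      exact ⟨fun x hx => ⟨Nat.zero_le _, by rw [h2 x hx, hS x hx]; omega⟩, h4⟩
    · rintro ⟨h2, h4⟩
      refine ⟨fun x hx => by rw [(h2 x hx).2, hS x hx]; omega, fun x hx y hy hxy => ?_, h4⟩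
      have := hE x y hxy
      have := hS x hx
      have := hS y hy
      omega
  rw [layeredSeries, PowerSeries.coeff_mk, add_comm, h, card_topFill]
  simp [powDiffSeries]

/-! ### Induction on down-closed sets -/

/-- A down-closed set with an element of rank at least `s` has elements of all ranks up to `s`. -/
theorem exists_rank_eq {V : Type*} {ρ : V → ℕ} {E : V → V → Prop} (hE : ∀ x y, E x y → ρ y = ρ x + 1)
    (hpred : ∀ y, ρ y ≠ 0 → ∃ x, E x y) {S : Finset V} (hS : ∀ x y, E x y → y ∈ S → x ∈ S)
    {s : ℕ} (hs : ∃ x ∈ S, s ≤ ρ x) : ∃ x ∈ S, ρ x = s := by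
  obtain ⟨x, hx, hsx⟩ := hs
  obtain ⟨k, hk⟩ := Nat.exists_eq_add_of_le hsx
  clear hsx
  induction k generalizing x with
  | zero => exact ⟨x, hx, hk⟩
  | succ k ih =>
    obtain ⟨y, hy⟩ := hpred x (by omega)
    have := hE y x hy
    exact ih y (hS y x hy hx) (by omega)

/-- The ranks `0, …, s` all occur. In the induction this makes the natural-number subtractions
giving the new degrees exact. -/
theorem succ_le_card_of_rank {V : Type*} [DecidableEq V] {ρ : V → ℕ} {E : V → V → Prop}
    (hE : ∀ x y, E x y → ρ y = ρ x + 1) (hpred : ∀ y, ρ y ≠ 0 → ∃ x, E x y) {S : Finset V}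
    (hS : ∀ x y, E x y → y ∈ S → x ∈ S) {s : ℕ} (hs : ∃ x ∈ S, s ≤ ρ x) : s + 1 ≤ S.card := by
  have : Finset.range (s + 1) ⊆ S.image ρ := by
    intro t ht
    rw [Finset.mem_range] at ht
    obtain ⟨x, hx, hsx⟩ := hs
    obtain ⟨y, hy, hyt⟩ := exists_rank_eq hE hpred hS (s := t) ⟨x, hx, by omega⟩
    exact Finset.mem_image.2 ⟨y, hy, hyt⟩
  simpa using (Finset.card_le_card this).trans Finset.card_image_le

theorem exists_sum_mem_gammaCone {ι : Type*} {d k : ℕ} (T : Finset ι) (f : ι → PowerSeries ℤ)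
    (g : PowerSeries ℤ)
    (h : ∀ i ∈ T, ∃ p ∈ gammaCone d, g * f i = PowerSeries.X ^ k * (p : PowerSeries ℤ)) :
    ∃ p ∈ gammaCone d, g * ∑ i ∈ T, f i = PowerSeries.X ^ k * (p : PowerSeries ℤ) := by
  choose! p hp hp' using h
  refine ⟨∑ i ∈ T, p i, sum_mem hp, ?_⟩
  have : ((∑ i ∈ T, p i : ℤ[X]) : PowerSeries ℤ) = ∑ i ∈ T, (p i : PowerSeries ℤ) :=
    map_sum (Polynomial.coeToPowerSeries.ringHom (R := ℤ)) p T
  rw [this, Finset.mul_sum, Finset.mul_sum]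
  exact Finset.sum_congr rfl hp'

/-- Up to a power of the variable, the numerator of the generating function of the layered maps
on a down-closed set has nonnegative `γ`-coefficients. -/
theorem exists_layeredSeries {ρ : V → ℕ} {E : V → V → Prop}
    (hE : ∀ x y, E x y → ρ y = ρ x + 1) (hpred : ∀ y, ρ y ≠ 0 → ∃ x, E x y) (S : Finset V)
    (hS : ∀ x y, E x y → y ∈ S → x ∈ S) (s d : ℕ) (hs : ∃ x ∈ S, s ≤ ρ x)
    (hd : d + s + 1 = S.card) :
    ∃ p ∈ gammaCone d, (1 - PowerSeries.X) ^ S.card * layeredSeries ρ E S (s % 2) =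
      PowerSeries.X ^ (s / 2) * (p : PowerSeries ℤ) := by
  induction hn : S.card using Nat.strong_induction_on generalizing S s d with
  | _ n ih =>
  subst hn
  -- A single parity forces `s = 0`: an element of positive rank has a predecessor of the other
  -- parity in `S`.
  by_cases hpar : ∀ x ∈ S, ρ x % 2 = s % 2
  · have hs0 : s = 0 := by
      by_contra hs0
      obtain ⟨x, hx, hsx⟩ := hs
      obtain ⟨y, hy⟩ := hpred x (by omega)
      have := hE y x hy
      have := hpar x hx
      have := hpar y (hS y x hy hx)
      omega
    subst hs0
    rw [layeredSeries_of_even hE hpar]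
    obtain ⟨p, hp, h⟩ := exists_powDiffSeries S.card (by omega)
    exact ⟨p, by rwa [show d = S.card - 1 by omega], by simpa using h⟩
  push Not at hpar
  have hdown : ∀ A ∈ topRuns ρ E S s, ∀ x y, E x y → y ∈ S \ A → x ∈ S \ A := by
    intro A hA x y hxy hy
    rw [mem_topRuns] at hA
    rw [Finset.mem_sdiff] at hy ⊢
    exact ⟨hS x y hxy hy.1, fun hx => (hA.2 x hx).2 y hy.1 hxy⟩
  have hcardA : ∀ A ∈ topRuns ρ E S s, (S \ A).card + A.card = S.card := by
    intro A hA
    rw [mem_topRuns] at hA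
    exact Finset.card_sdiff_add_card_eq_card hA.1
  have hempty : powDiffSeries 0 = 0 := by ext w; simp [powDiffSeries]
  rcases Nat.eq_zero_or_pos s with rfl | hspos
  · rw [Nat.zero_mod, layeredSeries_zero hE hpar]
    refine exists_sum_mem_gammaCone _ _ _ fun A hA => ?_
    by_cases hA0 : A.card = 0
    -- An empty run never attains the maximum, so its term is zero.
    · exact ⟨0, zero_mem _, by simp [hA0, hempty]⟩
    have hc := hcardA A hA
    obtain ⟨x, hx, hx2⟩ := hpar
    have hxA : x ∈ S \ A :=
      Finset.mem_sdiff.2 ⟨hx, fun h => hx2 ((mem_topRuns.1 hA).2 x h).1⟩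
    have hex : ∃ x ∈ S \ A, 1 ≤ ρ x := ⟨x, hxA, by omega⟩
    have hle := succ_le_card_of_rank hE hpred (hdown A hA) hex
    obtain ⟨p, hp, h⟩ := ih (S \ A).card (by omega) (S \ A) (hdown A hA) 1
      ((S \ A).card - 2) hex (by omega) rfl
    obtain ⟨q, hq, h'⟩ := exists_powDiffSeries A.card hA0
    -- The degrees add up: `(|S \ A| - 2) + (|A| - 1) + 2 = |S| - 1`, the `2` coming from `X`.
    refine ⟨X * (p * q), ?_, ?_⟩
    · convert X_mul_mem_gammaCone (mul_mem_gammaCone hp hq) using 2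
      omega
    · rw [← hc, pow_add, Polynomial.coe_mul, Polynomial.coe_mul, ← h', Polynomial.coe_X]
      simp only [Nat.one_mod, Nat.reduceDiv, pow_zero, one_mul] at h
      rw [← h]
      ring
  · have hlow : ∀ A ∈ topRuns ρ E S s, ∃ x ∈ S \ A, s - 1 ≤ ρ x := by
      intro A hA
      obtain ⟨x, hx, hsx⟩ := hs
      by_cases hxA : x ∈ A
      · obtain ⟨y, hy⟩ := hpred x (by omega)
        have := hE y x hy
        have hyS := hS y x hy hx
        refine ⟨y, Finset.mem_sdiff.2 ⟨hyS, fun h => ?_⟩, by omega⟩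
        exact ((mem_topRuns.1 hA).2 y h).2 x hx hy
      · exact ⟨x, Finset.mem_sdiff.2 ⟨hx, hxA⟩, by omega⟩
    have key : ∀ A ∈ topRuns ρ E S s, ∃ p ∈ gammaCone d, (1 - PowerSeries.X) ^ S.card *
        (layeredSeries ρ E (S \ A) ((s - 1) % 2) * powDiffSeries A.card) =
        PowerSeries.X ^ ((s - 1) / 2) * (p : PowerSeries ℤ) := by
      intro A hA
      by_cases hA0 : A.card = 0
      · exact ⟨0, zero_mem _, by simp [hA0, hempty]⟩
      have hc := hcardA A hA
      have hle := succ_le_card_of_rank hE hpred (hdown A hA) (hlow A hA)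
      obtain ⟨p, hp, h⟩ := ih (S \ A).card (by omega) (S \ A) (hdown A hA) (s - 1)
        ((S \ A).card - s) (hlow A hA) (by omega) rfl
      obtain ⟨q, hq, h'⟩ := exists_powDiffSeries A.card hA0
      -- Here `(|S \ A| - s) + (|A| - 1) = |S| - s - 1`. The factor `X` from an even top run, for
      -- even `s`, goes into `X ^ (s / 2)`.
      refine ⟨p * q, ?_, ?_⟩
      · convert mul_mem_gammaCone hp hq using 2
        omega
      · rw [← hc, pow_add, Polynomial.coe_mul, ← h', ← mul_assoc (PowerSeries.X ^ _), ← h]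
        ring
    have htop : ∀ c, s % 2 = c % 2 → topRuns ρ E S s = topRuns ρ E S c := by
      intro c hc
      ext A
      simp [mem_topRuns, hc]
    rcases Nat.mod_two_eq_zero_or_one s with h2 | h2
    · rw [h2] at hpar ⊢
      rw [layeredSeries_zero hE hpar]
      refine exists_sum_mem_gammaCone _ _ _ fun A hA => ?_
      rw [← htop 0 h2] at hA
      obtain ⟨p, hp, h⟩ := key A hA
      refine ⟨p, hp, ?_⟩
      rw [show (s - 1) % 2 = 1 by omega] at h
      rw [mul_left_comm, h, ← mul_assoc, ← pow_succ', show (s - 1) / 2 + 1 = s / 2 by omega]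
    · rw [h2] at hpar ⊢
      rw [layeredSeries_one hE hpar]
      refine exists_sum_mem_gammaCone _ _ _ fun A hA => ?_
      rw [← htop 1 (by omega)] at hA
      obtain ⟨p, hp, h⟩ := key A hA
      refine ⟨p, hp, ?_⟩
      rw [show (s - 1) % 2 = 0 by omega] at h
      rw [h, show (s - 1) / 2 = s / 2 by omega]

end Layered

/-! ### P-partitions and the descent generating function -/

/-- The sequences ending in `m` whose consecutive differences are at least those prescribed
by `e`. -/
def stepSeqs (n : ℕ) (e : Fin n → ℕ) (m : ℕ) : Finset (Fin (n + 1) → ℕ) :=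
  {g ∈ Fintype.piFinset fun _ => Finset.range (m + 1) |
    (∀ i : Fin n, g i.castSucc + e i ≤ g i.succ) ∧ g (Fin.last n) = m}

theorem mem_stepSeqs {n : ℕ} {e : Fin n → ℕ} {m : ℕ} {g : Fin (n + 1) → ℕ} :
    g ∈ stepSeqs n e m ↔
      (∀ i : Fin n, g i.castSucc + e i ≤ g i.succ) ∧ g (Fin.last n) = m := by
  simp only [stepSeqs, Finset.mem_filter, Fintype.mem_piFinset, Finset.mem_range,
    Nat.lt_succ_iff, and_iff_right_iff_imp]
  rintro ⟨h, rfl⟩ i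
  exact Fin.monotone_iff_le_succ.2 (fun i => (Nat.le_add_right _ _).trans (h i)) (Fin.le_last i)

theorem card_stepSeqs_succ (n : ℕ) (e : Fin (n + 1) → ℕ) (m : ℕ) :
    (stepSeqs (n + 1) e m).card = ∑ p ∈ Finset.HasAntidiagonal.antidiagonal m,
      (stepSeqs n (fun i => e i.castSucc) p.1).card * if e (Fin.last n) ≤ p.2 then 1 else 0 := by
  rw [Finset.card_eq_sum_card_fiberwise
    (f := fun g => (g (Fin.last n).castSucc, m - g (Fin.last n).castSucc))
    (t := Finset.HasAntidiagonal.antidiagonal m)]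
  · refine Finset.sum_congr rfl ?_
    rintro ⟨p, q⟩ hpq
    rw [Finset.HasAntidiagonal.mem_antidiagonal] at hpq
    simp only at hpq ⊢
    split_ifs with he
    · rw [mul_one]
      refine Finset.card_nbij' (fun g i => g i.castSucc)
        (fun g => (Fin.snoc (α := fun _ => ℕ) g m : Fin (n + 2) → ℕ)) ?_ ?_ ?_ ?_
      · intro g hg
        simp only [Finset.mem_coe, Finset.mem_filter, mem_stepSeqs, Prod.mk.injEq] at hg ⊢
        exact ⟨fun i => hg.1.1 i.castSucc, hg.2.1⟩
      · intro g hg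
        simp only [Finset.mem_coe, Finset.mem_filter, mem_stepSeqs, Prod.mk.injEq,
          Fin.snoc_castSucc, Fin.snoc_last] at hg ⊢
        refine ⟨⟨fun i => ?_, trivial⟩, hg.2, by omega⟩
        refine Fin.lastCases ?_ (fun i => ?_) i
        · simp only [Fin.succ_last, Fin.snoc_last]
          omega
        · simp only [Fin.succ_castSucc, Fin.snoc_castSucc]
          exact hg.1 i
      · intro g hg
        simp only [Finset.mem_coe, Finset.mem_filter, mem_stepSeqs] at hg
        funext i
        refine Fin.lastCases ?_ (fun i => ?_) i
        · simp only [Fin.snoc_last, hg.1.2]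
        · simp only [Fin.snoc_castSucc]
      · intro g _
        funext i
        simp only [Fin.snoc_castSucc]
    · rw [mul_zero, Finset.card_eq_zero, Finset.filter_eq_empty_iff]
      intro g hg h
      rw [mem_stepSeqs] at hg
      rw [Prod.mk.injEq] at h
      have := hg.1 (Fin.last n)
      rw [Fin.succ_last, hg.2] at this
      omega
  · intro g hg
    simp only [Finset.mem_coe, mem_stepSeqs, Finset.HasAntidiagonal.mem_antidiagonal] at hg ⊢
    have := hg.1 (Fin.last n)
    rw [Fin.succ_last, hg.2] at this
    omega

/-- The first value and the `n` excesses over the prescribed steps are free, each giving a factor `1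
/ (1 - X)`. -/
theorem one_sub_X_pow_mul_stepSeqs (n : ℕ) (e : Fin n → ℕ) :
    (1 - PowerSeries.X) ^ (n + 1) *
      (PowerSeries.mk fun m => ((stepSeqs n e m).card : ℤ)) = PowerSeries.X ^ ∑ i, e i := by
  have h1 : (PowerSeries.mk 1 : PowerSeries ℤ) * (1 - PowerSeries.X) = 1 :=
    PowerSeries.mk_one_mul_one_sub_eq_one ℤ
  induction n with
  | zero =>
    have h : (PowerSeries.mk fun m => ((stepSeqs 0 e m).card : ℤ)) = PowerSeries.mk 1 := by
      ext m
      have : stepSeqs 0 e m = {fun _ => m} := by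
        ext g
        rw [mem_stepSeqs, Finset.mem_singleton, funext_iff, Fin.forall_fin_one]
        simp
      simp [this]
    rw [h, zero_add, pow_one, mul_comm, h1]
    simp
  | succ n ih =>
    have h : (PowerSeries.mk fun m => ((stepSeqs (n + 1) e m).card : ℤ)) =
        (PowerSeries.mk fun m => ((stepSeqs n (fun i => e i.castSucc) m).card : ℤ)) *
          (PowerSeries.X ^ e (Fin.last n) * PowerSeries.mk 1) := by
      ext m
      rw [PowerSeries.coeff_mul, PowerSeries.coeff_mk, card_stepSeqs_succ, Nat.cast_sum]
      refine Finset.sum_congr rfl fun p _ => ?_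
      rw [PowerSeries.coeff_X_pow_mul']
      simp
    rw [h, Fin.sum_univ_castSucc, pow_add _ (∑ i, _), ← ih fun i => e i.castSucc]
    linear_combination (1 - PowerSeries.X) ^ (n + 1) *
      (PowerSeries.mk fun m => ((stepSeqs n (fun i => e i.castSucc) m).card : ℤ)) *
      PowerSeries.X ^ e (Fin.last n) * h1

open Classical in
/-- The order-preserving maps to the natural numbers with maximum `m`. -/
noncomputable def orderMaps {n : ℕ} (P : PartialOrder (Fin n)) (m : ℕ) : Finset (Fin n → ℕ) :=
  {f ∈ Fintype.piFinset fun _ => Finset.range (m + 1) |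
    (∀ x y, P.lt x y → f x ≤ f y) ∧ ∃ x, f x = m}

theorem mem_orderMaps {n : ℕ} {P : PartialOrder (Fin n)} {m : ℕ} {f : Fin n → ℕ} :
    f ∈ orderMaps P m ↔
      (∀ x, f x ≤ m) ∧ (∀ x y, P.lt x y → f x ≤ f y) ∧ ∃ x, f x = m := by
  classical
  simp [orderMaps]

/-- Values of `f` with ties broken by `ω`. -/
def refinedKey {n : ℕ} (ω f : Fin n → ℕ) (x : Fin n) : ℕ ×ₗ ℕ := toLex (f x, ω x)

theorem refinedKey_lt {n : ℕ} {ω f : Fin n → ℕ} {x y : Fin n} :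
    refinedKey ω f x < refinedKey ω f y ↔ f x < f y ∨ f x = f y ∧ ω x < ω y := by
  simp [refinedKey, Prod.Lex.toLex_lt_toLex]

theorem refinedKey_injective {n : ℕ} {ω : Fin n → ℕ} (hω : Function.Injective ω)
    (f : Fin n → ℕ) : Function.Injective (refinedKey ω f) := by
  intro x y h
  have := congrArg ofLex h
  simp only [refinedKey, ofLex_toLex, Prod.mk.injEq] at this
  exact hω this.2

theorem strictMono_refinedKey_sort {n : ℕ} {ω : Fin n → ℕ} (hω : Function.Injective ω)
    (f : Fin n → ℕ) : StrictMono (refinedKey ω f ∘ Tuple.sort (refinedKey ω f)) :=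
  (Tuple.monotone_sort _).strictMono_of_injective
    ((refinedKey_injective hω f).comp (Equiv.injective _))

theorem sort_eq_iff_strictMono {n : ℕ} {ω : Fin n → ℕ} (hω : Function.Injective ω)
    (f : Fin n → ℕ) (π : Equiv.Perm (Fin n)) :
    Tuple.sort (refinedKey ω f) = π ↔ StrictMono (refinedKey ω f ∘ π) := by
  constructor
  · rintro rfl
    exact strictMono_refinedKey_sort hω f
  · intro h
    have := Tuple.unique_monotone (f := refinedKey ω f) (Tuple.monotone_sort _) h.monotone
    ext1 i
    exact refinedKey_injective hω f (congrFun this i)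

/-- Ties are allowed only where `ω` increases, so `f` must rise strictly at each descent of `ω ∘ π`.
-/
theorem strictMono_refinedKey_comp_iff {n : ℕ} {ω : Fin (n + 1) → ℕ}
    (hω : Function.Injective ω) (f : Fin (n + 1) → ℕ) (π : Equiv.Perm (Fin (n + 1))) :
    StrictMono (refinedKey ω f ∘ π) ↔ ∀ i : Fin n,
      f (π i.castSucc) + (if ω (π i.succ) < ω (π i.castSucc) then 1 else 0) ≤ f (π i.succ) := by
  rw [Fin.strictMono_iff_lt_succ]
  refine forall_congr' fun i => ?_
  have hne : ω (π i.castSucc) ≠ ω (π i.succ) := fun h =>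
    (Fin.castSucc_lt_succ (i := i)).ne (π.injective (hω h))
  simp only [Function.comp, refinedKey_lt]
  split_ifs <;> omega

theorem le_apply_last_of_strictMono {n : ℕ} {ω f : Fin (n + 1) → ℕ}
    (hω : Function.Injective ω) {π : Equiv.Perm (Fin (n + 1))}
    (hf : StrictMono (refinedKey ω f ∘ π)) (x : Fin (n + 1)) : f x ≤ f (π (Fin.last n)) := by
  have h2 := hf.monotone (Fin.le_last (π.symm x))
  simp only [Function.comp, Equiv.apply_symm_apply] at h2
  rcases h2.lt_or_eq with h3 | h3
  · rw [refinedKey_lt] at h3; omega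
  · rw [refinedKey_injective hω f h3]

theorem isLinearExtension_sort_iff {n : ℕ} {P : PartialOrder (Fin n)} {ω : Fin n → ℕ}
    (hω : Function.Injective ω) (hP : ∀ x y, P.lt x y → ω x < ω y) (f : Fin n → ℕ) :
    IsLinearExtension P (Tuple.sort (refinedKey ω f)) ↔ ∀ x y, P.lt x y → f x ≤ f y := by
  have key : ∀ x y, (Tuple.sort (refinedKey ω f)).symm x < (Tuple.sort (refinedKey ω f)).symm y ↔
      refinedKey ω f x < refinedKey ω f y := by
    intro x y
    rw [← (strictMono_refinedKey_sort hω f).lt_iff_lt]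
    simp
  refine forall₂_congr fun x y => imp_congr_right fun hxy => ?_
  rw [key, refinedKey_lt]
  have := hP x y hxy
  omega

/-- The number of descents of the word `ω ∘ π`. -/
def keyDescents {n : ℕ} (ω : Fin (n + 1) → ℕ) (π : Equiv.Perm (Fin (n + 1))) : ℕ :=
  ∑ i : Fin n, if ω (π i.succ) < ω (π i.castSucc) then 1 else 0

/-- The fundamental lemma of `P`-partitions for a natural labeling `ω`. -/
theorem one_sub_X_pow_mul_orderMaps {n : ℕ} (P : PartialOrder (Fin (n + 1)))
    {ω : Fin (n + 1) → ℕ} (hω : Function.Injective ω) (hP : ∀ x y, P.lt x y → ω x < ω y) :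
    (1 - PowerSeries.X) ^ (n + 1) *
      (PowerSeries.mk fun m => ((orderMaps P m).card : ℤ)) =
      ∑ π ∈ linearExtensions P, PowerSeries.X ^ keyDescents ω π := by
  classical
  have h : (PowerSeries.mk fun m => ((orderMaps P m).card : ℤ)) = ∑ π ∈ linearExtensions P,
      PowerSeries.mk fun m => ((stepSeqs n
        (fun i => if ω (π i.succ) < ω (π i.castSucc) then 1 else 0) m).card : ℤ) := by
    ext m
    rw [map_sum, PowerSeries.coeff_mk, Finset.card_eq_sum_card_fiberwise
      (f := fun f => Tuple.sort (refinedKey ω f)) (t := linearExtensions P), Nat.cast_sum]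
    · refine Finset.sum_congr rfl fun π hπ => ?_
      rw [PowerSeries.coeff_mk, Nat.cast_inj]
      refine Finset.card_nbij' (fun f => f ∘ π) (fun g => g ∘ π.symm) ?_ ?_ ?_ ?_
      · intro f hf
        simp only [Finset.mem_coe, Finset.mem_filter, mem_orderMaps,
          sort_eq_iff_strictMono hω] at hf
        obtain ⟨⟨h1, -, x, hx⟩, h2⟩ := hf
        rw [Finset.mem_coe, mem_stepSeqs]
        refine ⟨(strictMono_refinedKey_comp_iff hω f π).1 h2, le_antisymm (h1 _) ?_⟩
        rw [← hx]
        exact le_apply_last_of_strictMono hω h2 x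
      · intro g hg
        rw [Finset.mem_coe, mem_stepSeqs] at hg
        have h2 := (strictMono_refinedKey_comp_iff hω (g ∘ π.symm) π).2 (by simpa using hg.1)
        have hlast : (g ∘ π.symm) (π (Fin.last n)) = m := by simpa using hg.2
        simp only [Finset.mem_coe, Finset.mem_filter, mem_orderMaps]
        have hs := (sort_eq_iff_strictMono hω _ _).2 h2
        refine ⟨⟨fun x => hlast ▸ le_apply_last_of_strictMono hω h2 x, ?_, _, hlast⟩, hs⟩
        rw [← isLinearExtension_sort_iff hω hP, hs]
        simpa [linearExtensions] using hπ
      · intro f _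
        funext x
        simp
      · intro g _
        funext x
        simp
    · intro f hf
      simp only [Finset.mem_coe, mem_orderMaps] at hf
      simp only [linearExtensions, Finset.coe_filter, Finset.mem_univ, true_and, Set.mem_ofPred_eq]
      exact (isLinearExtension_sort_iff hω hP f).2 hf.2.1
  rw [h, Finset.mul_sum]
  exact Finset.sum_congr rfl fun π _ => one_sub_X_pow_mul_stepSeqs n _

/-! ### Ranks and covers in the chainlink poset -/

/-- The rank of an element of the `r`-chainlink poset. -/
def chainlinkRank (r : ℕ) {n : ℕ} (x : Fin n) : ℕ := (x : ℕ) % (r + 1)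

/-- The relations of the `r`-chainlink poset between consecutive ranks. -/
def chainlinkCover (r : ℕ) {n : ℕ} (x y : Fin n) : Prop :=
  chainlinkLE r n x y ∧ chainlinkRank r y = chainlinkRank r x + 1

theorem block_of_label {r a b : ℕ} (hb : b ≤ r) : ((r + 1) * a + b) / (r + 1) = a := by
  rw [Nat.mul_add_div (Nat.succ_pos r), Nat.div_eq_of_lt (Nat.lt_succ_of_le hb), add_zero]

theorem rank_of_label {r a b : ℕ} (hb : b ≤ r) : ((r + 1) * a + b) % (r + 1) = b := by
  rw [Nat.mul_add_mod, Nat.mod_eq_of_lt (Nat.lt_succ_of_le hb)]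

theorem exists_label (r x : ℕ) : ∃ a b, b ≤ r ∧ x = (r + 1) * a + b :=
  ⟨x / (r + 1), x % (r + 1), Nat.lt_succ_iff.1 (Nat.mod_lt _ (Nat.succ_pos r)),
    (Nat.div_add_mod x (r + 1)).symm⟩

theorem chainlinkLE_mk {r n a b c d : ℕ} (hb : b ≤ r) (hd : d ≤ r) (hx : (r + 1) * a + b < n)
    (hy : (r + 1) * c + d < n) :
    chainlinkLE r n ⟨(r + 1) * a + b, hx⟩ ⟨(r + 1) * c + d, hy⟩ ↔ c ≤ a ∧ a + b ≤ c + d := by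
  simp only [chainlinkLE, block_of_label hb, block_of_label hd, rank_of_label hb,
    rank_of_label hd]

theorem chainlinkRank_mk {r n a b : ℕ} (hb : b ≤ r) (hx : (r + 1) * a + b < n) :
    chainlinkRank r (⟨(r + 1) * a + b, hx⟩ : Fin n) = b := rank_of_label hb

theorem exists_fin_label (r : ℕ) {n : ℕ} (x : Fin n) :
    ∃ a b, b ≤ r ∧ ∃ h : (r + 1) * a + b < n, x = ⟨(r + 1) * a + b, h⟩ := by
  obtain ⟨a, b, hb, h⟩ := exists_label r x
  exact ⟨a, b, hb, h ▸ x.2, Fin.ext h⟩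

theorem chainlinkRank_le {r n : ℕ} (x : Fin n) : chainlinkRank r x ≤ r :=
  Nat.lt_succ_iff.1 (Nat.mod_lt _ (Nat.succ_pos r))

theorem chainlinkCover_rank {r n : ℕ} (x y : Fin n) (h : chainlinkCover r x y) :
    chainlinkRank r y = chainlinkRank r x + 1 := h.2

theorem exists_chainlinkCover_below {r n : ℕ} (y : Fin n) (hy : chainlinkRank r y ≠ 0) :
    ∃ x, chainlinkCover r x y := by
  obtain ⟨a, b, hb, h, rfl⟩ := exists_fin_label r y
  rw [chainlinkRank_mk hb] at hy
  obtain ⟨b, rfl⟩ := Nat.exists_eq_succ_of_ne_zero hy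
  refine ⟨⟨(r + 1) * a + b, by omega⟩, (chainlinkLE_mk (by omega) hb _ _).2 (by omega), ?_⟩
  rw [chainlinkRank_mk hb, chainlinkRank_mk (by omega)]

theorem exists_chainlinkCover_above {r n : ℕ} (hn : r + 1 ≤ n) (x : Fin n)
    (hx : chainlinkRank r x < r) : ∃ y, chainlinkCover r x y := by
  obtain ⟨a, b, hb, h, rfl⟩ := exists_fin_label r x
  rw [chainlinkRank_mk hb] at hx
  -- For `a > 0` the cover in the preceding block has a smaller label. For `a = 0` truncation keeps
  -- the element in block `0`, which is full because `r + 1 ≤ n`.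
  have hlt : (r + 1) * (a - 1) + (b + 1) < n := by
    rcases a with _ | a
    · simp; omega
    · rw [mul_add] at h; simp; omega
  refine ⟨⟨(r + 1) * (a - 1) + (b + 1), hlt⟩,
    (chainlinkLE_mk hb (by omega) _ _).2 (by omega), ?_⟩
  rw [chainlinkRank_mk hb, chainlinkRank_mk (by omega)]

theorem exists_chainlinkCover_le {r n : ℕ} {x y : Fin n} (h : chainlinkLE r n x y)
    (hne : x ≠ y) : ∃ z, chainlinkCover r x z ∧ chainlinkLE r n z y := by
  obtain ⟨a, b, hb, hx, rfl⟩ := exists_fin_label r x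
  obtain ⟨c, d, hd, hy, rfl⟩ := exists_fin_label r y
  rw [chainlinkLE_mk hb hd] at h
  have hbd : b < d := by
    by_contra hc
    exact hne (by rw [Fin.mk.injEq, show a = c by omega, show b = d by omega])
  rcases h.1.lt_or_eq with hca | rfl
  · obtain ⟨a, rfl⟩ := Nat.exists_eq_add_of_lt hca
    have hz : (r + 1) * (c + a) + (b + 1) < n := by
      rw [mul_add (r + 1) (c + a)] at hx; omega
    refine ⟨⟨(r + 1) * (c + a) + (b + 1), hz⟩, ⟨(chainlinkLE_mk hb (by omega) _ _).2 (by omega),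
      ?_⟩, (chainlinkLE_mk (by omega) hd _ _).2 (by omega)⟩
    rw [chainlinkRank_mk hb, chainlinkRank_mk (by omega)]
  · refine ⟨⟨(r + 1) * c + (b + 1), by omega⟩, ⟨(chainlinkLE_mk hb (by omega) _ _).2 (by omega),
      ?_⟩, (chainlinkLE_mk (by omega) hd _ _).2 (by omega)⟩
    rw [chainlinkRank_mk hb, chainlinkRank_mk (by omega)]

theorem chainlinkLE_antisymm {r n : ℕ} {x y : Fin n} (h : chainlinkLE r n x y)
    (h' : chainlinkLE r n y x) : x = y :=
  (chainlinkPoset r n).le_antisymm x y h h'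

theorem chainlinkPoset_lt_iff {r n : ℕ} {x y : Fin n} :
    (chainlinkPoset r n).lt x y ↔ chainlinkLE r n x y ∧ x ≠ y := by
  refine and_congr_right fun h => ⟨?_, fun hne h' => hne (chainlinkLE_antisymm h h')⟩
  rintro h' rfl
  exact h' h

theorem chainlinkCover_lt {r n : ℕ} {x y : Fin n} (h : chainlinkCover r x y) :
    (chainlinkPoset r n).lt x y := by
  refine chainlinkPoset_lt_iff.2 ⟨h.1, ?_⟩
  rintro rfl
  exact absurd h.2 (by omega)

/-- A map that is weakly increasing along the covers is order-preserving. -/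
theorem le_of_chainlinkLE {r n : ℕ} {f : Fin n → ℕ}
    (hf : ∀ x y, chainlinkCover r x y → f x ≤ f y) {x y : Fin n} (h : chainlinkLE r n x y) :
    f x ≤ f y := by
  induction hk : r - chainlinkRank r x using Nat.strong_induction_on generalizing x with
  | _ k ih =>
  by_cases hne : x = y
  · rw [hne]
  obtain ⟨z, hxz, hzy⟩ := exists_chainlinkCover_le h hne
  have := hxz.2
  have := chainlinkRank_le (r := r) z
  exact (hf x z hxz).trans (ih _ (by omega) hzy rfl)

theorem exists_chainlinkLE_top {r n : ℕ} (hn : r + 1 ≤ n) (x : Fin n) :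
    ∃ y, chainlinkLE r n x y ∧ chainlinkRank r y = r := by
  induction hk : r - chainlinkRank r x using Nat.strong_induction_on generalizing x with
  | _ k ih =>
  rcases (chainlinkRank_le (r := r) x).lt_or_eq with h | h
  · obtain ⟨z, hz⟩ := exists_chainlinkCover_above hn x h
    have := hz.2
    obtain ⟨y, hy, hyr⟩ := ih _ (by omega) z rfl
    exact ⟨y, (chainlinkPoset r n).le_trans x z y hz.1 hy, hyr⟩
  · exact ⟨x, (chainlinkPoset r n).le_refl x, h⟩

/-- Values rise by at least one along a chain of covers from rank `0`. This makes the subtraction in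
`(h - rank) / 2` exact. -/
theorem rank_le_of_mem_layered {r n v : ℕ} {h : Fin n → ℕ}
    (hh : h ∈ layered (chainlinkRank r) (chainlinkCover r) Finset.univ v) (x : Fin n) :
    chainlinkRank r x ≤ h x := by
  rw [mem_layered] at hh
  induction hk : chainlinkRank r x using Nat.strong_induction_on generalizing x with
  | _ k ih =>
  by_cases h0 : chainlinkRank r x = 0
  · omega
  obtain ⟨y, hy⟩ := exists_chainlinkCover_below x h0
  have h1 := hy.2
  have h2 := ih _ (by omega) y rfl
  have h3 := hh.2.2.2.1 y (Finset.mem_univ _) x (Finset.mem_univ _) hy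
  omega

theorem rank_eq_of_mem_layered {r n v : ℕ} (hn : r + 1 ≤ n) {h : Fin n → ℕ}
    (hh : h ∈ layered (chainlinkRank r) (chainlinkCover r) Finset.univ v) {x : Fin n}
    (hx : h x = v) : chainlinkRank r x = r := by
  rw [mem_layered] at hh
  by_contra hne
  have := chainlinkRank_le (r := r) x
  obtain ⟨y, hy⟩ := exists_chainlinkCover_above hn x (by omega)
  have h1 := hh.2.2.2.1 x (Finset.mem_univ _) y (Finset.mem_univ _) hy
  have h2 := hh.2.1 y (Finset.mem_univ _)
  omega

/-! ### From order-preserving maps to layered maps -/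

/-- The transfer `f ↦ 2 * f + rank` from order-preserving maps to layered maps. -/
theorem card_layered_univ {r n : ℕ} (hn : r + 1 ≤ n) (m : ℕ) :
    (layered (chainlinkRank r (n := n)) (chainlinkCover r) Finset.univ (2 * m + r)).card =
      (orderMaps (chainlinkPoset r n) m).card := by
  symm
  refine Finset.card_nbij' (fun f x => 2 * f x + chainlinkRank r x)
    (fun h x => (h x - chainlinkRank r x) / 2) ?_ ?_ ?_ ?_
  · intro f hf
    simp only [Finset.mem_coe, mem_orderMaps] at hf
    obtain ⟨h1, h2, x, hx⟩ := hf
    rw [Finset.mem_coe, mem_layered]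
    beta_reduce
    refine ⟨fun x hx => absurd (Finset.mem_univ x) hx, fun x _ => ?_, fun x _ => by omega,
      fun x _ y _ hxy => ?_, ?_⟩
    · have := h1 x
      have := chainlinkRank_le (r := r) x
      omega
    · have := h2 x y (chainlinkCover_lt hxy)
      have := hxy.2
      omega
    · obtain ⟨y, hxy, hy⟩ := exists_chainlinkLE_top hn x
      have h3 := le_of_chainlinkLE (fun x y hxy => h2 x y (chainlinkCover_lt hxy)) hxy
      have h4 := h1 y
      exact ⟨y, Finset.mem_univ _, by rw [hy]; omega⟩
  · intro h hh
    have hle := rank_le_of_mem_layered hh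
    have htop := fun x => rank_eq_of_mem_layered hn hh (x := x)
    rw [Finset.mem_coe, mem_layered] at hh
    obtain ⟨-, h1, h2, h3, x, -, hx⟩ := hh
    have hcov : ∀ x y, chainlinkCover r x y →
        (h x - chainlinkRank r x) / 2 ≤ (h y - chainlinkRank r y) / 2 := by
      intro x y hxy
      have := h3 x (Finset.mem_univ _) y (Finset.mem_univ _) hxy
      have := hxy.2
      omega
    rw [Finset.mem_coe, mem_orderMaps]
    beta_reduce
    refine ⟨fun y => ?_, fun y z hyz => le_of_chainlinkLE hcov hyz.1, x, ?_⟩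
    · obtain ⟨z, hyz, hz⟩ := exists_chainlinkLE_top hn y
      have h4 := le_of_chainlinkLE hcov hyz
      have h5 := h1 z (Finset.mem_univ _)
      omega
    · have := htop x hx
      omega
  · intro f _
    funext x
    simp
  · intro h hh
    have hle := rank_le_of_mem_layered hh
    rw [Finset.mem_coe, mem_layered] at hh
    funext x
    have := hle x
    have := hh.2.2.1 x (Finset.mem_univ _)
    simp only
    omega

theorem layeredSeries_univ {r n : ℕ} (hn : r + 1 ≤ n) :
    layeredSeries (chainlinkRank r (n := n)) (chainlinkCover r) Finset.univ (r % 2) =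
      PowerSeries.X ^ (r / 2) *
        PowerSeries.mk fun m => ((orderMaps (chainlinkPoset r n) m).card : ℤ) := by
  ext w
  rw [PowerSeries.coeff_X_pow_mul', layeredSeries, PowerSeries.coeff_mk]
  split_ifs with hw
  · rw [PowerSeries.coeff_mk, ← card_layered_univ hn,
      show 2 * w + r % 2 = 2 * (w - r / 2) + r by omega]
  -- The maximum is attained at rank `r`, so it is at least `r`, and the first `r / 2` coefficients
  -- vanish.
  · rw [Nat.cast_eq_zero, Finset.card_eq_zero, Finset.eq_empty_iff_forall_notMem]
    intro h hh
    obtain ⟨x, -, hx⟩ := (mem_layered.1 hh).2.2.2.2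
    have h1 := rank_eq_of_mem_layered hn hh hx
    have h2 := rank_le_of_mem_layered hh x
    omega

/-! ### The natural labeling and its descents -/

/-- A natural labeling of the `r`-chainlink poset, ordering lexicographically by block plus rank
and then by decreasing block. -/
def chainlinkLabel (r n : ℕ) (x : Fin n) : ℕ :=
  ((x : ℕ) / (r + 1) + (x : ℕ) % (r + 1)) * (n + 1) + (n - (x : ℕ) / (r + 1))

theorem chainlinkLabel_lt_iff {r n : ℕ} {x y : Fin n} :
    chainlinkLabel r n x < chainlinkLabel r n y ↔
      (x : ℕ) / (r + 1) + (x : ℕ) % (r + 1) < (y : ℕ) / (r + 1) + (y : ℕ) % (r + 1) ∨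
      (x : ℕ) / (r + 1) + (x : ℕ) % (r + 1) = (y : ℕ) / (r + 1) + (y : ℕ) % (r + 1) ∧
        (y : ℕ) / (r + 1) < (x : ℕ) / (r + 1) := by
  have hx : (x : ℕ) / (r + 1) ≤ n := (Nat.div_le_self _ _).trans x.2.le
  have hy : (y : ℕ) / (r + 1) ≤ n := (Nat.div_le_self _ _).trans y.2.le
  unfold chainlinkLabel
  generalize (x : ℕ) / (r + 1) = a at *
  generalize (y : ℕ) / (r + 1) = c at *
  generalize a + (x : ℕ) % (r + 1) = s
  generalize c + (y : ℕ) % (r + 1) = t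
  rcases lt_trichotomy s t with h | rfl | h
  · have := Nat.mul_le_mul_right (n + 1) (Nat.succ_le_of_lt h)
    rw [Nat.succ_mul] at this
    omega
  · omega
  · have := Nat.mul_le_mul_right (n + 1) (Nat.succ_le_of_lt h)
    rw [Nat.succ_mul] at this
    omega

theorem chainlinkLabel_injective (r n : ℕ) : Function.Injective (chainlinkLabel r n) := by
  intro x y h
  have h1 := mt chainlinkLabel_lt_iff.2 h.not_lt
  have h2 := mt chainlinkLabel_lt_iff.2 h.not_gt
  apply chainlinkLE_antisymm (r := r) <;> unfold chainlinkLE <;> omega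

theorem chainlinkLabel_lt_of_lt {r n : ℕ} (x y : Fin n) (h : (chainlinkPoset r n).lt x y) :
    chainlinkLabel r n x < chainlinkLabel r n y := by
  rw [chainlinkLabel_lt_iff]
  have h1 : chainlinkLE r n x y := h.1
  have h2 : ¬ chainlinkLE r n y x := h.2
  unfold chainlinkLE at h1 h2
  omega

/-- In a linear extension the `r`-descents are the descents of the natural labeling. -/
theorem descent_iff_chainlinkLabel_lt {r n : ℕ} {π : Equiv.Perm (Fin (n + 1))}
    (hπ : IsLinearExtension (chainlinkPoset r (n + 1)) π) (i : Fin n) :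
    (π i.succ : ℕ) + r < (π i.castSucc : ℕ) ↔
      chainlinkLabel r (n + 1) (π i.succ) < chainlinkLabel r (n + 1) (π i.castSucc) := by
  have hlt : i.castSucc < i.succ := Fin.castSucc_lt_succ
  have hne : π i.castSucc ≠ π i.succ := fun h => hlt.ne (π.injective h)
  have hback : ¬ chainlinkLE r (n + 1) (π i.succ) (π i.castSucc) := by
    intro h
    have := hπ _ _ (chainlinkPoset_lt_iff.2 ⟨h, hne.symm⟩)
    simp only [Equiv.symm_apply_apply] at this
    exact lt_asymm hlt this
  -- The two entries are consecutive in the word, so no element lies strictly between them; if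
  -- comparable, they form a cover.
  have hbetween : ∀ z, chainlinkCover r (π i.castSucc) z → chainlinkLE r (n + 1) z (π i.succ) →
      z = π i.succ := by
    intro z h1 h2
    by_contra hz
    have h3 := hπ _ _ (chainlinkCover_lt h1)
    have h4 := hπ _ _ (chainlinkPoset_lt_iff.2 ⟨h2, hz⟩)
    simp only [Equiv.symm_apply_apply, Fin.lt_def, Fin.val_castSucc, Fin.val_succ] at h3 h4
    omega
  rw [chainlinkLabel_lt_iff]
  generalize π i.castSucc = x at *
  generalize π i.succ = y at *
  have hcover : chainlinkLE r (n + 1) x y → chainlinkCover r x y := by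
    intro h
    obtain ⟨z, h1, h2⟩ := exists_chainlinkCover_le h hne
    rwa [← hbetween z h1 h2]
  clear hbetween hπ
  obtain ⟨a, b, hb, hx, rfl⟩ := exists_fin_label r x
  obtain ⟨c, d, hd, hy, rfl⟩ := exists_fin_label r y
  rw [chainlinkCover, chainlinkLE_mk hb hd, chainlinkRank_mk hb, chainlinkRank_mk hd] at hcover
  rw [chainlinkLE_mk hd hb] at hback
  simp only [block_of_label hb, block_of_label hd, rank_of_label hb, rank_of_label hd]
  constructor
  · intro h
    have hca : c < a := by
      by_contra hc
      have := Nat.mul_le_mul_left (r + 1) (not_lt.1 hc)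
      have : a ≠ c := by rintro rfl; omega
      have := Nat.mul_le_mul_left (r + 1) (show a + 1 ≤ c by omega)
      rw [mul_add] at this
      omega
    by_contra hcon
    -- Otherwise `x < y` would be a cover joining consecutive blocks; then `x - y = r` as labels,
    -- which just fails to be an `r`-descent.
    have := hcover (by omega)
    have hac : a = c + 1 := by omega
    subst hac
    rw [mul_add] at h
    omega
  · intro h
    -- `a ≤ c` would give `y ≤ x` in the poset, excluded by `hback`.
    have hca : c < a := by omega
    obtain ⟨k, rfl⟩ := Nat.exists_eq_add_of_lt hca
    have hs : c + d < c + k + 1 + b := by omega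
    -- Since `d - b ≤ k`, the difference of the labels is at least `r * k + r + 1 > r`.
    have : (r + 1) * (c + k + 1) = (r + 1) * c + r * k + k + (r + 1) := by ring
    rw [this]
    have := Nat.zero_le (r * k)
    omega

theorem descentNumber_eq_keyDescents {r n : ℕ} {π : Equiv.Perm (Fin (n + 1))}
    (hπ : IsLinearExtension (chainlinkPoset r (n + 1)) π) :
    descentNumber r π = keyDescents (chainlinkLabel r (n + 1)) π := by
  classical
  rw [descentNumber, descentSet, Finset.card_filter, Fin.sum_univ_castSucc, keyDescents]
  have hlast : ¬ ∃ h : ((Fin.last n : Fin (n + 1)) : ℕ) + 1 < n + 1,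
      (π ⟨((Fin.last n : Fin (n + 1)) : ℕ) + 1, h⟩ : ℕ) + r < (π (Fin.last n) : ℕ) := by
    rintro ⟨h, -⟩
    simp at h
  rw [if_neg hlast, add_zero]
  refine Finset.sum_congr rfl fun i _ => if_congr ?_ rfl rfl
  rw [← descent_iff_chainlinkLabel_lt hπ i]
  have hi : ((i.castSucc : Fin (n + 1)) : ℕ) + 1 < n + 1 := by simp
  exact ⟨fun ⟨_, h⟩ => h, fun h => ⟨hi, h⟩⟩

/-! ### The two cases of the theorem -/

theorem chainlinkEulerian_eq_X_mul {r n : ℕ} (hn : r + 1 ≤ n) :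
    ∃ p ∈ gammaCone (n - r - 1), chainlinkEulerian r n = X * p := by
  obtain ⟨n, rfl⟩ : ∃ k, n = k + 1 := ⟨n - 1, by omega⟩
  have hs : ∃ x ∈ (Finset.univ : Finset (Fin (n + 1))), r ≤ chainlinkRank r x :=
    ⟨⟨r, by omega⟩, Finset.mem_univ _, (Nat.mod_eq_of_lt (Nat.lt_succ_self r)).ge⟩
  obtain ⟨p, hp, h⟩ := exists_layeredSeries chainlinkCover_rank exists_chainlinkCover_below
    (Finset.univ : Finset (Fin (n + 1))) (fun _ _ _ _ => Finset.mem_univ _) r (n + 1 - r - 1) hs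
    (by rw [Finset.card_univ, Fintype.card_fin]; omega)
  have h2 := one_sub_X_pow_mul_orderMaps (chainlinkPoset r (n + 1))
    (chainlinkLabel_injective r (n + 1)) chainlinkLabel_lt_of_lt
  rw [layeredSeries_univ hn, Finset.card_univ, Fintype.card_fin, mul_left_comm, h2] at h
  -- The power `X ^ (r / 2)` from the shift `2 m + r` is the one split off in
  -- `exists_layeredSeries`.
  have h3 := mul_left_cancel₀ (pow_ne_zero _ PowerSeries.X_ne_zero) h
  refine ⟨p, hp, ?_⟩
  have h4 : (∑ π ∈ linearExtensions (chainlinkPoset r (n + 1)), X ^ descentNumber r π : ℤ[X])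
      = p := by
    apply Polynomial.coe_injective ℤ
    rw [← h3]
    refine (map_sum (Polynomial.coeToPowerSeries.ringHom (R := ℤ)) _ _).trans ?_
    refine Finset.sum_congr rfl fun π hπ => ?_
    have hπ' : IsLinearExtension (chainlinkPoset r (n + 1)) π := by
      simpa [linearExtensions] using hπ
    simp [descentNumber_eq_keyDescents hπ']
  rw [← h4, chainlinkEulerian, Finset.mul_sum]
  exact Finset.sum_congr rfl fun π _ => pow_add _ _ _ |>.trans (by rw [pow_one])

theorem chainlinkEulerian_of_le {r n : ℕ} (hn : n ≤ r) : chainlinkEulerian r n = X := by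
  -- All elements lie in block `0`, so the poset is a chain in the usual order.
  have hlt : ∀ x y : Fin n, (chainlinkPoset r n).lt x y ↔ x < y := by
    intro x y
    rw [chainlinkPoset_lt_iff, chainlinkLE, Nat.div_eq_of_lt (by omega),
      Nat.div_eq_of_lt (by omega), Nat.mod_eq_of_lt (by omega), Nat.mod_eq_of_lt (by omega),
      Fin.lt_def, ne_eq, Fin.ext_iff]
    omega
  have h : linearExtensions (chainlinkPoset r n) = {1} := by
    ext π
    simp only [linearExtensions, Finset.mem_filter, Finset.mem_univ, true_and,
      Finset.mem_singleton, IsLinearExtension, hlt]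
    constructor
    · intro hπ
      have h1 : StrictMono π.symm := fun x y hxy => hπ x y hxy
      have h2 := (Equiv.Perm.monotone_iff π.symm).1 h1.monotone
      exact inv_eq_one.1 h2
    · rintro rfl x y hxy
      exact hxy
  have hd : descentSet r (1 : Equiv.Perm (Fin n)) = ∅ := by
    rw [Finset.eq_empty_iff_forall_notMem]
    intro i hi
    rw [descentSet, Finset.mem_filter] at hi
    obtain ⟨-, _, hi⟩ := hi
    simp only [Equiv.Perm.coe_one, id_eq] at hi
    omega
  rw [chainlinkEulerian, h, Finset.sum_singleton, descentNumber, hd, Finset.card_empty, add_zero,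
    pow_one]

theorem theorem6p3 (r n : ℕ) (hn : 1 ≤ n) :
    (r + 1 ≤ n → ∃ γ : ℕ → ℕ,
      chainlinkEulerian r n =
        X * ∑ j ∈ Finset.range ((n - r - 1) / 2 + 1),
          (γ j : ℤ[X]) * (X ^ j * (1 + X) ^ (n - r - 1 - 2 * j))) ∧
    (n ≤ r → chainlinkEulerian r n = X) := by
  refine ⟨fun h => ?_, chainlinkEulerian_of_le⟩
  obtain ⟨p, hp, h'⟩ := chainlinkEulerian_eq_X_mul h
  obtain ⟨γ, rfl⟩ := exists_gamma_of_mem_gammaCone hp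
  exact ⟨γ, h'⟩
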